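/- All graphs are finite, simple and connected. An instance is a pair $(G,\mathbf{x})$ where $\mathbf{x}$ assigns to every node a binary string (its input). A distributed language is a decidable, isomorphism-invariant collection of instances; it is a graph language if all inputs in its instances are empty, and then its members are regarded as graphs. Nodes receive pairwise distinct identities in $\mathbb{N}$. A $t$-round algorithm outputs "yes" or "no" at each node $u$ as a function of the ball $B(u,t)$ of radius $t$ around $u$ (without the edges between two nodes at distance exactly $t$ from $u$) together with the inputs, certificates (binary strings) and identities of its nodes. It verifies $\mathcal{L}$ if for every instance in $\mathcal{L}$ there is a certificate vector with which all nodes output "yes" under every identity assignment, and for every instance not in $\mathcal{L}$, every certificate vector and every identity assignment, some node outputs "no". NLD is the class of distributed languages verified by a (computable) algorithm in a constant number of rounds. A proof labeling scheme is defined likewise, except that the certificates (labels) may depend on the identities. A $t$-local isomorphism from $I$ to $I'$ is a map of nodes that preserves edges and inputs and restricts, for every node $v$, to an isomorphism from the radius-$t$ ball around $v$ onto the radius-$t$ ball around its image. A language $\mathcal{L}$ is $t$-closed under lift if $I\in\mathcal{L}$ whenever there is a $t$-local isomorphism from $I$ to a member of $\mathcal{L}$. For a family $\mathcal{F}$ of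 graphs, $\textsf{Seed-}\mathcal{F}$ is the family of all graphs that admit a $1$-local isomorphism to a member of $\mathcal{F}$. **Proposition.** There are families $\mathcal{F}_n$ ($n\ge 0$) of $n$-node graphs, whose union $\mathcal{F}=\bigcup_n\mathcal{F}_n$ is a graph language, such that: 1. Proof labels for $\mathcal{F}_n$ need $\Omega(n^2)$ bits: for every $t$ there are $c>0$ and $N$ such that for every $n\ge N$ and every $t$-round proof labeling scheme that is correct for $\mathcal{F}_n$ on all $n$-node instances, there are a graph in $\mathcal{F}_n$ and an identity assignment for which every accepted label vector has a label of at least $cn^2$ bits. 2. For every $n$, $\textsf{Seed-}\mathcal{F}_n$ is $1$-closed under lift and belongs to NLD; likewise $\textsf{Seed-}\mathcal{F}$ is $1$-closed under lift and belongs to NLD. 3. For every prime $n$ and every instance $G$ with $n$ nodes, $G\in\textsf{Seed-}\mathcal{F}_n\iff G\in\mathcal{F}_n\iff G\in\textsf{Seed-}\mathcal{F}$. 4. Every algorithm verifying the graph language $\textsf{Seed-}\mathcal{F}$ requires certificates of $\Omega(n^2)$ bits: for every $t$ there are $c>0$ and $N$ such that for every $t$-round algorithm verifying $\textsf{Seed-}\mathcal{F}$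 and every $n\ge N$ there is an $n$-node graph in $\textsf{Seed-}\mathcal{F}$ for which every certificate vector accepted at all nodes under every identity assignment has a certificate of at least $cn^2$ bits. In particular there is a graph language in NLD for which every verification algorithm requires certificates of $\Omega(n^2)$ bits. -/

import Mathlib

/-- An input instance `(G, x)`: a finite connected simple graph `G`, each node of which carries a
binary string as its local input. -/
structure Network where
  size : ℕ
  graph : SimpleGraph (Fin size)
  connected : graph.Connected
  input : Fin size → List Bool

namespace Network

/-- The nodes of an instance. -/
abbrev Node (I : Network) : Type := Fin I.size

/-- The vertex set of the ball `B(u, t)`. -/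
def ball (I : Network) (u : I.Node) (t : ℕ) : Set I.Node := {v | I.graph.dist u v ≤ t}

/-- Adjacency in the ball `B(u, t)`: the edges of the graph between two nodes of the ball, except
those between two nodes at distance exactly `t` from `u`. -/
def BallAdj (I : Network) (u : I.Node) (t : ℕ) (v w : I.Node) : Prop :=
  v ∈ I.ball u t ∧ w ∈ I.ball u t ∧ I.graph.Adj v w ∧
    ¬ (I.graph.dist u v = t ∧ I.graph.dist u w = t)

/-- `f` is a `t`-local isomorphism from `I` to `J`: a homomorphism that preserves the inputs and
restricts, for each node `v`, to an isomorphism from `B(v, t)` to `B(f v, t)`. -/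
structure IsLocalIso (t : ℕ) (I J : Network) (f : I.Node → J.Node) : Prop where
  map_adj : ∀ u v, I.graph.Adj u v → J.graph.Adj (f u) (f v)
  map_input : ∀ v, J.input (f v) = I.input v
  bijOn_ball : ∀ v, Set.BijOn f (I.ball v t) (J.ball (f v) t)
  ballAdj_iff : ∀ v, ∀ a ∈ I.ball v t, ∀ b ∈ I.ball v t,
    (I.BallAdj v t a b ↔ J.BallAdj (f v) t (f a) (f b))

/-- Isomorphism of instances. -/
def Isomorphic (I J : Network) : Prop :=
  ∃ e : I.graph ≃g J.graph, ∀ v, J.input (e v) = I.input v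

open Classical in
/-- The standard encoding of an instance as finite data: adjacency matrix and list of inputs. -/
noncomputable def code (I : Network) : List (List Bool) × List (List Bool) :=
  (List.ofFn fun i => List.ofFn fun j => decide (I.graph.Adj i j), List.ofFn I.input)

end Network

/-- What a node learns in a constant number of rounds: its own identity, and one record for each
node of its ball: the identity, the input and the certificate of that node, and the identities of
its neighbours in the ball. -/
abbrev LocalView : Type := ℕ × List (ℕ × List Bool × List Bool × List ℕ)

namespace Network

open Classical in
/-- The nodes of the ball `B(u, t)`, listed by increasing identity. -/
noncomputable def ballList (I : Network) (ident : I.Node → ℕ) (t : ℕ) (u : I.Node) :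
    List I.Node :=
  ((List.finRange I.size).filter fun v => decide (v ∈ I.ball u t)).mergeSort
    fun a b => decide (ident a ≤ ident b)

open Classical in
/-- The ball `B(u, t)` with all inputs, certificates and identities. As the nodes are named by
their identities and listed by increasing identity, it shows nothing else about the instance. -/
noncomputable def view (I : Network) (ident : I.Node → ℕ) (cert : I.Node → List Bool) (t : ℕ)
    (u : I.Node) : LocalView :=
  (ident u, (I.ballList ident t u).map fun v =>
    (ident v, I.input v, cert v,
      ((I.ballList ident t u).filter fun w => decide (I.BallAdj u t v w)).map ident))

/-- Every node outputs "yes" when the algorithm `A` runs for `t` rounds on the instance `I` with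
identities `ident` and certificates `cert`. -/
def AllAccept (I : Network) (t : ℕ) (A : LocalView → Bool) (ident : I.Node → ℕ)
    (cert : I.Node → List Bool) : Prop :=
  ∀ u, A (I.view ident cert t u) = true

end Network

/-- A distributed language: a decidable, isomorphism-invariant collection of instances. -/
def IsDistributedLanguage (L : Set Network) : Prop :=
  (∀ I J : Network, I.Isomorphic J → (I ∈ L ↔ J ∈ L)) ∧
    ∃ d : List (List Bool) × List (List Bool) → Bool,
      Computable d ∧ ∀ I : Network, I ∈ L ↔ d I.code = true

/-- A graph language: all inputs are empty. -/
def IsGraphLanguage (L : Set Network) : Prop := ∀ I ∈ L, ∀ v, I.input v = []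

/-- The `t`-round algorithm with output function `A` verifies `L` in the (non-anonymous) LOCAL
model. The certificates must not depend on the identities. -/
def Verifies (t : ℕ) (A : LocalView → Bool) (L : Set Network) : Prop :=
  (∀ I ∈ L, ∃ cert, ∀ ident, Function.Injective ident → I.AllAccept t A ident cert) ∧
    (∀ I ∉ L, ∀ cert, ∀ ident, Function.Injective ident → ¬ I.AllAccept t A ident cert)

/-- The class NLD: distributed languages verified by an algorithm in constantly many rounds. -/
def NLD : Set (Set Network) :=
  {L | IsDistributedLanguage L ∧ ∃ (t : ℕ) (A : LocalView → Bool), Computable A ∧ Verifies t A L}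

/-- `A`, with `t` rounds, is the verifier of a proof labeling scheme for `L` on the `n`-node
instances. Here the labels may depend on the identities. -/
def IsProofLabelingScheme (n t : ℕ) (A : LocalView → Bool) (L : Set Network) : Prop :=
  ∀ I : Network, I.size = n → ∀ ident : I.Node → ℕ, Function.Injective ident →
    (I ∈ L ↔ ∃ label, I.AllAccept t A ident label)

/-- `L` is `t`-closed under lift. -/
def ClosedUnderLift (t : ℕ) (L : Set Network) : Prop :=
  ∀ I J : Network, (∃ f, Network.IsLocalIso t I J f) → J ∈ L → I ∈ L

/-- The graphs that have a seed in `F`, i.e. a `1`-local isomorphism onto a member of `F`. -/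
def SeedLanguage (F : Set Network) : Set Network :=
  {I | ∃ H ∈ F, ∃ f, Network.IsLocalIso 1 I H f}

/-!
The members of the family are the graphs isomorphic to some `doubleGraph n M M`: a path on `n`
vertices with the same bit matrix `M`, of side `n / 8`, written as chords into two blocks that are
far apart on the path.

*Lower bounds.* Suppose that short certificates suffice for all `doubleGraph n M M`, with the
identities `0, …, n - 1`. If the certificates for `M` and for `M'` agree on a window of `2 * t`
vertices between the blocks, then they can be spliced into accepted certificates of
`doubleGraph n M M'` (`allAccept_splice`), so this graph is in the language and hence isomorphic to
some `doubleGraph n N N`. It is not necessary to know which pairs `(M, M')` admit such an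
isomorphism: there are few contents of the window, so some content is shared by a large set of
matrices, and the square of the size of that set is at most `n !` times the number of matrices `N`
(`sq_card_le_of_forall_iso`). This is impossible unless certificates have quadratic length
(`exists_matrix_of_long_certificates`).

*Seeds.* A `1`-local isomorphism is a covering of graphs that preserves the inputs
(`Network.isLocalIso_one_iff`), and all fibres of a covering of a connected graph have the same size
(`IsCovering.card_fiber_eq`). So a graph of prime size only covers graphs of its own size. A graph
`doubleGraph n M M'` with `8 ≤ n` has exactly one leaf, so the connected graphs that it covers are
isomorphic to it (`exists_iso_of_mem_seedLanguage`), and the lower bound holds for the seed language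
as well.

*Upper bounds.* The family and the seed languages all have the form `coverLanguage R`. Membership is
decidable by a search over all maps to a vertex set that is not larger, and all matrices
(`coverSearch_code_iff`). To verify it in one round, each certificate states the covered graph and
the image of the node, and each node checks that it sees a covering (`CoverCheck`). Both
computations are shown to be primitive recursive.
-/

/-! ### Coverings of graphs -/

/-- `f` is a covering of the graph `H` by the graph `G`: it maps the neighbours of each vertex
bijectively onto the neighbours of its image. -/
def IsCovering {V W : Type*} (G : SimpleGraph V) (H : SimpleGraph W) (f : V → W) : Prop :=
  ∀ v, Set.BijOn f (G.neighborSet v) (H.neighborSet (f v))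

namespace IsCovering

variable {V W X : Type*} {G : SimpleGraph V} {H : SimpleGraph W} {K : SimpleGraph X} {f : V → W}

theorem map_adj (hf : IsCovering G H f) {u v : V} (h : G.Adj u v) : H.Adj (f u) (f v) :=
  (hf u).mapsTo h

theorem eq_of_adj (hf : IsCovering G H f) {u v v' : V} (h : G.Adj u v) (h' : G.Adj u v')
    (he : f v = f v') : v = v' :=
  (hf u).injOn h h' he

theorem exists_adj (hf : IsCovering G H f) {u : V} {j : W} (h : H.Adj (f u) j) :
    ∃ v, G.Adj u v ∧ f v = j :=
  (hf u).surjOn h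

theorem comp {g : W → X} (hg : IsCovering H K g) (hf : IsCovering G H f) :
    IsCovering G K (g ∘ f) :=
  fun v => (hg (f v)).comp (hf v)

theorem of_iso (e : G ≃g H) : IsCovering G H e := by
  refine fun v => ⟨fun w hw => e.map_adj_iff.2 hw, e.injective.injOn, fun w hw => ?_⟩
  refine ⟨e.symm w, ?_, e.apply_symm_apply w⟩
  have h : H.Adj (e v) (e (e.symm w)) := by simpa using hw
  exact e.map_adj_iff.1 h

/-- A bijective covering is an isomorphism. -/
theorem nonempty_iso (hf : IsCovering G H f) (hb : Function.Bijective f) :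
    Nonempty (G ≃g H) := by
  refine ⟨⟨Equiv.ofBijective f hb, fun {u v} => ⟨fun h => ?_, fun h => hf.map_adj h⟩⟩⟩
  obtain ⟨v', h', he⟩ := hf.exists_adj h
  rwa [← hb.1 he]

theorem card_fiber_le_of_adj [Fintype V] [DecidableEq W] (hf : IsCovering G H f) {j j' : W}
    (h : H.Adj j j') :
    (Finset.univ.filter fun v => f v = j).card ≤ (Finset.univ.filter fun v => f v = j').card := by
  classical
  have key : ∀ v, f v = j → ∃ u, G.Adj v u ∧ f u = j' := by
    rintro v rfl
    exact hf.exists_adj h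
  choose! g hg hg' using key
  refine Finset.card_le_card_of_injOn g (fun v hv => ?_) (fun v hv v' hv' he => ?_)
  · simpa using hg' v (by simpa using hv)
  · have hv : f v = j := by simpa using hv
    have hv' : f v' = j := by simpa using hv'
    have h' := hg v' hv'
    rw [← he] at h'
    exact hf.eq_of_adj (hg v hv).symm h'.symm (hv.trans hv'.symm)

/-- All fibres of a covering of a connected graph have the same size. -/
theorem card_fiber_eq [Fintype V] [DecidableEq W] (hf : IsCovering G H f) (hH : H.Connected)
    (j j' : W) :
    (Finset.univ.filter fun v => f v = j).card = (Finset.univ.filter fun v => f v = j').card := by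
  obtain ⟨p⟩ := hH.preconnected j j'
  induction p with
  | nil => rfl
  | cons h _ ih =>
    exact (le_antisymm (hf.card_fiber_le_of_adj h) (hf.card_fiber_le_of_adj h.symm)).trans ih

theorem card_eq_mul [Fintype V] [Fintype W] [DecidableEq W] (hf : IsCovering G H f)
    (hH : H.Connected) (j : W) :
    Fintype.card V = Fintype.card W * (Finset.univ.filter fun v => f v = j).card := by
  have h := Finset.card_eq_sum_card_fiberwise (f := f) (s := Finset.univ) (t := Finset.univ)
    (fun _ _ => by simp)
  rw [Finset.card_univ] at h
  rw [h, Finset.sum_congr rfl fun b _ => hf.card_fiber_eq hH b j]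
  simp

theorem bijective_of_card_fiber [Fintype V] [DecidableEq W] (hf : IsCovering G H f)
    (hH : H.Connected) (j : W) (hj : (Finset.univ.filter fun v => f v = j).card = 1) :
    Function.Bijective f := by
  have h : ∀ i, (Finset.univ.filter fun v => f v = i).card = 1 := fun i =>
    (hf.card_fiber_eq hH i j).trans hj
  refine ⟨fun u v he => ?_, fun i => ?_⟩
  · exact Finset.card_le_one.1 (h (f v)).le u (by simpa using he) v (by simp)
  · obtain ⟨v, hv⟩ := Finset.card_pos.1 ((h i).symm ▸ Nat.one_pos)
    exact ⟨v, by simpa using hv⟩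

theorem surjective [Fintype V] [Nonempty V] (hf : IsCovering G H f) (hH : H.Connected) :
    Function.Surjective f := by
  classical
  intro j
  obtain ⟨v⟩ := ‹Nonempty V›
  have h : 0 < (Finset.univ.filter fun u => f u = j).card := by
    rw [hf.card_fiber_eq hH j (f v)]
    exact Finset.card_pos.2 ⟨v, by simp⟩
  obtain ⟨u, hu⟩ := Finset.card_pos.1 h
  exact ⟨u, by simpa using hu⟩

/-- A covering onto a connected graph with the same number of vertices is a bijection. -/
theorem bijective_of_card_eq [Fintype V] [Fintype W] [Nonempty V] (hf : IsCovering G H f)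
    (hH : H.Connected) (h : Fintype.card V = Fintype.card W) : Function.Bijective f :=
  (Fintype.bijective_iff_surjective_and_card f).2 ⟨hf.surjective hH, h⟩

/-- A covering of a connected graph by a graph that has exactly one leaf is a bijection: the fibre
through the leaf consists of leaves, so it has one element, and so has every fibre. -/
theorem bijective_of_unique_leaf [Fintype V] (hf : IsCovering G H f)
    (hH : H.Connected) (v₀ : V) (h₀ : ∀ u u', G.Adj v₀ u → G.Adj v₀ u' → u = u')
    (h : ∀ v, v ≠ v₀ → ∃ u u', G.Adj v u ∧ G.Adj v u' ∧ u ≠ u') : Function.Bijective f := by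
  classical
  refine hf.bijective_of_card_fiber hH (f v₀) (Finset.card_eq_one.2 ⟨v₀, ?_⟩)
  ext v
  simp only [Finset.mem_filter, Finset.mem_univ, true_and, Finset.mem_singleton]
  refine ⟨fun he => ?_, fun he => he ▸ rfl⟩
  by_contra hv
  obtain ⟨u, u', hu, hu', hne⟩ := h v hv
  obtain ⟨x, hx, hxu⟩ := hf.exists_adj (he ▸ hf.map_adj hu)
  obtain ⟨y, hy, hyu⟩ := hf.exists_adj (he ▸ hf.map_adj hu')
  refine hne (hf.eq_of_adj hu hu' ?_)
  rw [← hxu, ← hyu, h₀ x y hx hy]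

end IsCovering

namespace Network

theorem mem_ball_one (I : Network) (u v : I.Node) : v ∈ I.ball u 1 ↔ v = u ∨ I.graph.Adj u v := by
  have h0 : I.graph.dist u v = 0 ↔ u = v := I.connected.dist_eq_zero_iff
  have h1 : I.graph.dist u v = 1 ↔ I.graph.Adj u v := SimpleGraph.dist_eq_one_iff_adj
  rw [ball, Set.mem_ofPred_eq, Nat.le_one_iff_eq_zero_or_eq_one, h0, h1, eq_comm]

theorem ballAdj_one_iff (I : Network) (u v w : I.Node) :
    I.BallAdj u 1 v w ↔ I.graph.Adj v w ∧ (v = u ∨ w = u) := by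
  simp only [BallAdj, mem_ball_one, SimpleGraph.dist_eq_one_iff_adj]
  constructor
  · rintro ⟨hv, hw, h, hn⟩
    exact ⟨h, by tauto⟩
  · rintro ⟨h, rfl | rfl⟩
    · exact ⟨Or.inl rfl, Or.inr h, h, fun hh => hh.1.ne rfl⟩
    · exact ⟨Or.inr h.symm, Or.inl rfl, h, fun hh => hh.2.ne rfl⟩

/-- The radius-`1` balls are stars, so a `1`-local isomorphism is the same as a covering of graphs
that preserves the inputs. -/
theorem isLocalIso_one_iff (I J : Network) (f : I.Node → J.Node) :
    IsLocalIso 1 I J f ↔ (∀ v, J.input (f v) = I.input v) ∧ IsCovering I.graph J.graph f := by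
  constructor
  · intro h
    refine ⟨h.map_input, fun v => ⟨fun a ha => h.map_adj v a ha, ?_, fun b hb => ?_⟩⟩
    · exact (h.bijOn_ball v).injOn.mono fun a ha => (I.mem_ball_one v a).2 (Or.inr ha)
    · have hb : J.graph.Adj (f v) b := hb
      obtain ⟨a, ha, rfl⟩ := (h.bijOn_ball v).surjOn ((J.mem_ball_one _ b).2 (Or.inr hb))
      rcases (I.mem_ball_one v a).1 ha with rfl | ha
      · exact absurd rfl hb.ne
      · exact ⟨a, ha, rfl⟩
  · rintro ⟨hin, hf⟩
    have inj : ∀ v, Set.InjOn f (I.ball v 1) := by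
      intro v a ha b hb he
      rw [mem_ball_one] at ha hb
      rcases ha with rfl | ha <;> rcases hb with rfl | hb
      · rfl
      · exact absurd he (hf.map_adj hb).ne
      · exact absurd he.symm (hf.map_adj ha).ne
      · exact hf.eq_of_adj ha hb he
    refine ⟨fun u v => hf.map_adj, hin, fun v => ⟨fun a ha => ?_, inj v, fun b hb => ?_⟩, ?_⟩
    · rw [mem_ball_one] at ha ⊢
      rcases ha with rfl | ha
      · exact Or.inl rfl
      · exact Or.inr (hf.map_adj ha)
    · rcases (J.mem_ball_one _ b).1 hb with rfl | hb
      · exact ⟨v, (I.mem_ball_one v v).2 (Or.inl rfl), rfl⟩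
      · obtain ⟨a, ha, rfl⟩ := hf.exists_adj hb
        exact ⟨a, (I.mem_ball_one v a).2 (Or.inr ha), rfl⟩
    · have back : ∀ v, ∀ b ∈ I.ball v 1, J.graph.Adj (f v) (f b) → I.graph.Adj v b := by
        intro v b hb h
        rcases (I.mem_ball_one v b).1 hb with rfl | hb
        · exact absurd rfl h.ne
        · exact hb
      intro v a ha b hb
      have hv : v ∈ I.ball v 1 := (I.mem_ball_one v v).2 (Or.inl rfl)
      rw [ballAdj_one_iff, ballAdj_one_iff]
      constructor
      · rintro ⟨h, h'⟩
        exact ⟨hf.map_adj h, h'.imp (congrArg f) (congrArg f)⟩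
      · rintro ⟨h, h' | h'⟩
        · obtain rfl := inj v ha hv h'
          exact ⟨back a b hb h, Or.inl rfl⟩
        · obtain rfl := inj v hb hv h'
          exact ⟨(back b a ha h.symm).symm, Or.inr rfl⟩

end Network

theorem mem_seedLanguage_iff (F : Set Network) (I : Network) :
    I ∈ SeedLanguage F ↔ ∃ H ∈ F, ∃ f : I.Node → H.Node,
      (∀ v, H.input (f v) = I.input v) ∧ IsCovering I.graph H.graph f := by
  simp only [SeedLanguage, Set.mem_ofPred_eq, Network.isLocalIso_one_iff]

theorem closedUnderLift_seedLanguage (F : Set Network) : ClosedUnderLift 1 (SeedLanguage F) := by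
  rintro I J ⟨f, hf⟩ hJ
  rw [Network.isLocalIso_one_iff] at hf
  rw [mem_seedLanguage_iff] at hJ ⊢
  obtain ⟨H, hH, g, hg, hg'⟩ := hJ
  exact ⟨H, hH, g ∘ f, fun v => (hg (f v)).trans (hf.1 v), hg'.comp hf.2⟩

/-! ### Primitive recursive predicates -/

attribute [fun_prop] Primrec Primrec.id Primrec.const Primrec.comp Primrec.pair

namespace Primrec

variable {α β γ : Type*} [Primcodable α] [Primcodable β] [Primcodable γ]

@[fun_prop]
theorem fst_comp {f : α → β × γ} (hf : Primrec f) : Primrec fun a => (f a).1 := fst.comp hf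

@[fun_prop]
theorem snd_comp {f : α → β × γ} (hf : Primrec f) : Primrec fun a => (f a).2 := snd.comp hf

@[fun_prop]
theorem add_comp {f g : α → ℕ} (hf : Primrec f) (hg : Primrec g) : Primrec fun a => f a + g a :=
  nat_add.comp hf hg

@[fun_prop]
theorem mul_comp {f g : α → ℕ} (hf : Primrec f) (hg : Primrec g) : Primrec fun a => f a * g a :=
  nat_mul.comp hf hg

@[fun_prop]
theorem div_comp {f g : α → ℕ} (hf : Primrec f) (hg : Primrec g) : Primrec fun a => f a / g a :=
  nat_div.comp hf hg

@[fun_prop]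
theorem mod_comp {f g : α → ℕ} (hf : Primrec f) (hg : Primrec g) : Primrec fun a => f a % g a :=
  nat_mod.comp hf hg

@[fun_prop]
theorem getD_comp {f : α → List β} {g : α → ℕ} (hf : Primrec f) (hg : Primrec g) (d : β) :
    Primrec fun a => (f a).getD (g a) d :=
  (list_getD d).comp hf hg

@[fun_prop]
theorem length_comp {f : α → List β} (hf : Primrec f) : Primrec fun a => (f a).length :=
  list_length.comp hf

@[fun_prop]
theorem range_comp {f : α → ℕ} (hf : Primrec f) : Primrec fun a => List.range (f a) :=
  list_range.comp hf

end Primrec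

namespace PrimrecPred

variable {α β : Type*} [Primcodable α] [Primcodable β]

theorem eq_comp {f g : α → β} (hf : Primrec f) (hg : Primrec g) :
    PrimrecPred fun a => f a = g a :=
  Primrec.eq.comp hf hg

theorem lt_comp {f g : α → ℕ} (hf : Primrec f) (hg : Primrec g) :
    PrimrecPred fun a => f a < g a :=
  Primrec.nat_lt.comp hf hg

theorem imp {p q : α → Prop} (hp : PrimrecPred p) (hq : PrimrecPred q) :
    PrimrecPred fun a => p a → q a :=
  (hp.not.or hq).of_eq fun _ => imp_iff_not_or.symm

theorem forall_mem_comp {f : α → List β} {r : α → β → Prop} (hf : Primrec f)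
    (hr : PrimrecPred fun p : α × β => r p.1 p.2) : PrimrecPred fun a => ∀ b ∈ f a, r a b :=
  (PrimrecRel.forall_mem_list (R := fun b a => r a b)
    (hr.comp (Primrec.snd.pair Primrec.fst))).comp hf Primrec.id

theorem exists_mem_comp {f : α → List β} {r : α → β → Prop} (hf : Primrec f)
    (hr : PrimrecPred fun p : α × β => r p.1 p.2) : PrimrecPred fun a => ∃ b ∈ f a, r a b :=
  (PrimrecRel.exists_mem_list (R := fun b a => r a b)
    (hr.comp (Primrec.snd.pair Primrec.fst))).comp hf Primrec.id

theorem forall_lt_comp {f : α → ℕ} {r : α → ℕ → Prop} (hf : Primrec f)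
    (hr : PrimrecPred fun p : α × ℕ => r p.1 p.2) : PrimrecPred fun a => ∀ b < f a, r a b :=
  (forall_mem_comp (Primrec.list_range.comp hf) hr).of_eq fun a => by simp

theorem exists_lt_comp {f : α → ℕ} {r : α → ℕ → Prop} (hf : Primrec f)
    (hr : PrimrecPred fun p : α × ℕ => r p.1 p.2) : PrimrecPred fun a => ∃ b < f a, r a b :=
  (exists_mem_comp (Primrec.list_range.comp hf) hr).of_eq fun a => by simp

theorem exists_computable {p : α → Prop} (hp : PrimrecPred p) :
    ∃ d : α → Bool, Computable d ∧ ∀ a, p a ↔ d a = true := by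
  obtain ⟨inst, hp⟩ := hp
  exact ⟨_, hp.to_comp, fun a => by simp⟩

end PrimrecPred

/-- All lists of length `n` with entries in the list `s`. -/
def tuples {α : Type*} (s : List α) (n : ℕ) : List (List α) :=
  Nat.rec [[]] (fun _ ls => ls.flatMap fun l => s.map fun a => a :: l) n

theorem mem_tuples {α : Type*} (s : List α) (n : ℕ) (l : List α) :
    l ∈ tuples s n ↔ l.length = n ∧ ∀ a ∈ l, a ∈ s := by
  induction n generalizing l with
  | zero =>
    have h0 : tuples s 0 = [[]] := rfl
    rw [h0, List.mem_singleton]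
    constructor
    · rintro rfl
      simp
    · exact fun h => List.length_eq_zero_iff.1 h.1
  | succ n ih =>
    have hs : tuples s (n + 1) = (tuples s n).flatMap fun l => s.map fun a => a :: l := rfl
    rw [hs, List.mem_flatMap]
    constructor
    · rintro ⟨l', hl', h⟩
      obtain ⟨a, ha, rfl⟩ := List.mem_map.1 h
      obtain ⟨h1, h2⟩ := (ih l').1 hl'
      refine ⟨by simp [h1], fun b hb => ?_⟩
      rcases List.mem_cons.1 hb with rfl | hb
      · exact ha
      · exact h2 b hb
    · rintro ⟨h1, h2⟩
      cases l with
      | nil => simp at h1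
      | cons a l' =>
        refine ⟨l', (ih l').2 ⟨by simpa using h1, fun b hb => h2 b (List.mem_cons_of_mem a hb)⟩,
          List.mem_map.2 ⟨a, h2 a List.mem_cons_self, rfl⟩⟩

@[fun_prop]
theorem primrec_tuples {α β : Type*} [Primcodable α] [Primcodable β] {f : α → List β} {g : α → ℕ}
    (hf : Primrec f) (hg : Primrec g) : Primrec fun a => tuples (f a) (g a) := by
  refine Primrec.nat_rec' (f := g) (g := fun _ => [[]])
    (h := fun a q => q.2.flatMap fun l => (f a).map fun b => b :: l) hg (Primrec.const _) ?_
  refine Primrec.list_flatMap (by fun_prop) (Primrec.list_map (by fun_prop) ?_)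
  exact Primrec.list_cons.comp Primrec.snd (by fun_prop)

/-! ### The graphs of the family -/

/-- The edges `i < j` of the graph `doubleGraph n M M'`. With `k = n / 8`, these are
* the path `0, 1, …, n - 1`, and a triangle on its last three vertices;
* for each `c < k * k` with `M c`, an edge from `1 + c / k` to `k + 2 + c % k`;
* for each `c < k * k` with `M' c`, an edge from `4 * k + c / k` to `5 * k + 1 + c % k`. -/
def DoubleRel (n : ℕ) (M M' : ℕ → Bool) (i j : ℕ) : Prop :=
  j = i + 1 ∨ (j = i + 2 ∧ j + 1 = n) ∨
    (∃ c < n / 8 * (n / 8), M c = true ∧ i = 1 + c / (n / 8) ∧ j = n / 8 + 2 + c % (n / 8)) ∨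
    (∃ c < n / 8 * (n / 8), M' c = true ∧ i = 4 * (n / 8) + c / (n / 8) ∧
      j = 5 * (n / 8) + 1 + c % (n / 8))

theorem DoubleRel.lt {n : ℕ} {M M' : ℕ → Bool} {i j : ℕ} (h : DoubleRel n M M' i j) : i < j := by
  rcases h with h | h | ⟨c, hc, -, h1, h2⟩ | ⟨c, hc, -, h1, h2⟩
  · omega
  · omega
  all_goals
    have := Nat.div_lt_of_lt_mul hc
    omega

/-- The graph on `n` vertices that encodes two square bit matrices `M` and `M'` of side `n / 8`,
written row by row, in two disjoint blocks of a path. A segment of the path of length about `n / 4`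
separates the blocks. Vertex `0` is a leaf, and the only one as soon as `8 ≤ n`. -/
def doubleGraph (n : ℕ) (M M' : ℕ → Bool) : SimpleGraph (Fin n) where
  Adj i j := DoubleRel n M M' i j ∨ DoubleRel n M M' j i
  symm := ⟨fun _ _ h => h.symm⟩
  loopless := ⟨fun _ h => h.elim (fun h => h.lt.ne rfl) fun h => h.lt.ne rfl⟩

theorem doubleGraph_adj {n : ℕ} {M M' : ℕ → Bool} {i j : Fin n} :
    (doubleGraph n M M').Adj i j ↔ DoubleRel n M M' i j ∨ DoubleRel n M M' j i := Iff.rfl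

theorem connected_doubleGraph {n : ℕ} (hn : 0 < n) (M M' : ℕ → Bool) :
    (doubleGraph n M M').Connected := by
  have h : ∀ i (hi : i < n), (doubleGraph n M M').Reachable ⟨0, hn⟩ ⟨i, hi⟩ := by
    intro i
    induction i with
    | zero => exact fun _ => SimpleGraph.Reachable.refl _
    | succ i ih =>
      intro hi
      refine (ih (by omega)).trans (SimpleGraph.Adj.reachable ?_)
      exact Or.inl (Or.inl rfl)
  have : Nonempty (Fin n) := ⟨⟨0, hn⟩⟩
  exact ⟨fun u v => (h u u.2).symm.trans (h v v.2)⟩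

/-- Only the first `(n / 8) ^ 2` bits of a matrix matter. -/
theorem doubleGraph_congr {n : ℕ} {M M' N N' : ℕ → Bool} (h : ∀ c < n / 8 * (n / 8), M c = N c)
    (h' : ∀ c < n / 8 * (n / 8), M' c = N' c) : doubleGraph n M M' = doubleGraph n N N' := by
  have key : ∀ i j, DoubleRel n M M' i j ↔ DoubleRel n N N' i j := by
    intro i j
    simp only [DoubleRel]
    refine or_congr Iff.rfl (or_congr Iff.rfl (or_congr ?_ ?_))
    · exact exists_congr fun c => and_congr_right fun hc => by rw [h c hc]
    · exact exists_congr fun c => and_congr_right fun hc => by rw [h' c hc]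
  ext i j
  rw [doubleGraph_adj, doubleGraph_adj, key, key]

/-- The graph `doubleGraph n M M'` as an instance with empty inputs. -/
def doubleNetwork (n : ℕ) (hn : 0 < n) (M M' : ℕ → Bool) : Network where
  size := n
  graph := doubleGraph n M M'
  connected := connected_doubleGraph hn M M'
  input _ := []

/-- The graphs isomorphic to a graph on `n` vertices that encodes the same matrix twice. -/
def equalityFamily (n : ℕ) : Set Network :=
  {I | (∀ v, I.input v = []) ∧ ∃ M, Nonempty (I.graph ≃g doubleGraph n M M)}

/-- The instances with empty inputs that cover a graph encoding the same matrix twice, on a number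
`m` of vertices that is related by `R` to the size of the instance. -/
def coverLanguage (R : ℕ → ℕ → Prop) : Set Network :=
  {I | (∀ v, I.input v = []) ∧ ∃ m, R I.size m ∧ ∃ M, ∃ f : I.Node → Fin m,
    IsCovering I.graph (doubleGraph m M M) f}

theorem Network.size_pos (I : Network) : 0 < I.size := by
  obtain ⟨v⟩ := I.connected.nonempty
  exact v.pos

instance (I : Network) : Nonempty I.Node := I.connected.nonempty

theorem size_of_mem_equalityFamily {n : ℕ} {I : Network} (h : I ∈ equalityFamily n) :
    I.size = n := by
  obtain ⟨-, M, ⟨e⟩⟩ := h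
  simpa using Fintype.card_congr e.toEquiv

theorem mem_seedLanguage_equalityFamily {n : ℕ} {I : Network} :
    I ∈ SeedLanguage (equalityFamily n) ↔ (∀ v, I.input v = []) ∧
      ∃ M, ∃ f : I.Node → Fin n, IsCovering I.graph (doubleGraph n M M) f := by
  rw [mem_seedLanguage_iff]
  constructor
  · rintro ⟨H, ⟨hH, M, ⟨e⟩⟩, f, hf, hc⟩
    exact ⟨fun v => by rw [← hf, hH], M, e ∘ f, (IsCovering.of_iso e).comp hc⟩
  · rintro ⟨hI, M, f, hf⟩
    have hn : 0 < n := (f ⟨0, I.size_pos⟩).pos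
    exact ⟨doubleNetwork n hn M M, ⟨fun _ => rfl, M, ⟨SimpleGraph.Iso.refl⟩⟩, f,
      fun v => (hI v).symm, hf⟩

theorem mem_seedLanguage_iUnion {ι : Type*} (F : ι → Set Network) (I : Network) :
    I ∈ SeedLanguage (⋃ n, F n) ↔ ∃ n, I ∈ SeedLanguage (F n) := by
  constructor
  · rintro ⟨H, hH, h⟩
    obtain ⟨n, hn⟩ := Set.mem_iUnion.1 hH
    exact ⟨n, H, hn, h⟩
  · rintro ⟨n, H, hn, h⟩
    exact ⟨H, Set.mem_iUnion.2 ⟨n, hn⟩, h⟩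

theorem seedLanguage_equalityFamily (n : ℕ) :
    SeedLanguage (equalityFamily n) = coverLanguage fun _ m => m = n := by
  ext I
  simp [mem_seedLanguage_equalityFamily, coverLanguage]

theorem seedLanguage_iUnion_equalityFamily :
    SeedLanguage (⋃ n, equalityFamily n) = coverLanguage fun _ _ => True := by
  ext I
  simp [mem_seedLanguage_iUnion, mem_seedLanguage_equalityFamily, coverLanguage]

theorem mem_equalityFamily_iff {I : Network} :
    I ∈ equalityFamily I.size ↔ I ∈ SeedLanguage (equalityFamily I.size) := by
  rw [mem_seedLanguage_equalityFamily]
  refine and_congr_right fun _ => exists_congr fun M => ⟨?_, ?_⟩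
  · rintro ⟨e⟩
    exact ⟨e, IsCovering.of_iso e⟩
  · rintro ⟨f, hf⟩
    exact hf.nonempty_iso
      (hf.bijective_of_card_eq (connected_doubleGraph I.size_pos M M) (by simp))

theorem iUnion_equalityFamily :
    (⋃ n, equalityFamily n) = coverLanguage fun s m => m = s := by
  ext I
  have h : I ∈ (⋃ n, equalityFamily n) ↔ I ∈ equalityFamily I.size := by
    rw [Set.mem_iUnion]
    refine ⟨fun ⟨n, hn⟩ => ?_, fun h => ⟨_, h⟩⟩
    rwa [size_of_mem_equalityFamily hn]
  rw [h, mem_equalityFamily_iff, mem_seedLanguage_equalityFamily]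
  simp [coverLanguage]

/-- An instance with a prime number of vertices only covers graphs with as many vertices or with
one vertex, and it has an edge. -/
theorem mem_equalityFamily_of_prime {I : Network} (hp : I.size.Prime) {m : ℕ}
    (h : I ∈ SeedLanguage (equalityFamily m)) : I ∈ equalityFamily I.size := by
  obtain ⟨hI, M, f, hf⟩ := mem_seedLanguage_equalityFamily.1 h
  have hm : 0 < m := (f ⟨0, I.size_pos⟩).pos
  have hd := hf.card_eq_mul (connected_doubleGraph hm M M) ⟨0, hm⟩
  simp only [Fintype.card_fin] at hd
  rcases hp.eq_one_or_self_of_dvd m ⟨_, hd⟩ with rfl | rfl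
  · have : Nontrivial I.Node := Fin.nontrivial_iff_two_le.2 hp.two_le
    obtain ⟨v, hv⟩ := I.connected.preconnected.exists_adj_of_nontrivial ⟨0, I.size_pos⟩
    exact absurd (Subsingleton.elim _ _) (hf.map_adj hv).ne
  · exact mem_equalityFamily_iff.2 h

/-! ### Decidability of the covering languages -/

theorem primrecPred_doubleRel {α : Type*} [Primcodable α] {n i j : α → ℕ} {w w' : α → List Bool}
    (hn : Primrec n) (hw : Primrec w) (hw' : Primrec w') (hi : Primrec i) (hj : Primrec j) :
    PrimrecPred fun a => DoubleRel (n a) (fun c => (w a).getD c false)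
      (fun c => (w' a).getD c false) (i a) (j a) := by
  refine .or (.eq_comp hj (by fun_prop)) (.or (.and (.eq_comp hj (by fun_prop))
    (.eq_comp (by fun_prop) hn)) (.or ?_ ?_))
  all_goals
    refine .exists_lt_comp (by fun_prop) (.and (.eq_comp ?_ (.const true))
      (.and (.eq_comp ?_ ?_) (.eq_comp ?_ ?_)))
    all_goals fun_prop

/-- Adjacency in `doubleGraph m M M`, with `M` given by a list of bits. -/
def DoubleAdj (m : ℕ) (w : List Bool) (i j : ℕ) : Prop :=
  DoubleRel m (fun c => w.getD c false) (fun c => w.getD c false) i j ∨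
    DoubleRel m (fun c => w.getD c false) (fun c => w.getD c false) j i

theorem primrecPred_doubleAdj {α : Type*} [Primcodable α] {n i j : α → ℕ} {w : α → List Bool}
    (hn : Primrec n) (hw : Primrec w) (hi : Primrec i) (hj : Primrec j) :
    PrimrecPred fun a => DoubleAdj (n a) (w a) (i a) (j a) :=
  .or (primrecPred_doubleRel hn hw hw hi hj) (primrecPred_doubleRel hn hw hw hj hi)

/-- `M` as a list of bits, of the length that matters to a graph on `m` vertices. -/
def bitList (m : ℕ) (M : ℕ → Bool) : List Bool := (List.range (m / 8 * (m / 8))).map M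

theorem doubleGraph_bitList (m : ℕ) (M : ℕ → Bool) :
    doubleGraph m (fun c => (bitList m M).getD c false) (fun c => (bitList m M).getD c false) =
      doubleGraph m M M := by
  have h : ∀ c < m / 8 * (m / 8), (bitList m M).getD c false = M c := by
    intro c hc
    simp [bitList, List.getD_eq_getElem?_getD, hc]
  exact doubleGraph_congr h h

/-- A covering of a graph that encodes the same matrix twice, in terms of numbers and lists. -/
theorem isCovering_doubleGraph_iff {V : Type*} {G : SimpleGraph V} {m : ℕ} {w : List Bool}
    {f : V → Fin m} :
    IsCovering G (doubleGraph m (fun c => w.getD c false) (fun c => w.getD c false)) f ↔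
      ∀ u, (∀ v, G.Adj u v → DoubleAdj m w (f u) (f v)) ∧
        (∀ v v', G.Adj u v → G.Adj u v' → (f v : ℕ) = f v' → v = v') ∧
        ∀ j < m, DoubleAdj m w (f u) j → ∃ v, G.Adj u v ∧ (f v : ℕ) = j := by
  constructor
  · intro h u
    refine ⟨fun v hv => h.map_adj hv, fun v v' hv hv' he => h.eq_of_adj hv hv' (Fin.ext he), ?_⟩
    intro j hj hadj
    obtain ⟨v, hv, he⟩ := h.exists_adj (u := u) (j := ⟨j, hj⟩) hadj
    exact ⟨v, hv, by rw [he]⟩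
  · intro h u
    refine ⟨fun v hv => (h u).1 v hv, fun v hv v' hv' he => ?_, fun j hj => ?_⟩
    · exact (h u).2.1 v v' hv hv' (congrArg Fin.val he)
    · obtain ⟨v, hv, he⟩ := (h u).2.2 j j.2 hj
      exact ⟨v, hv, Fin.ext he⟩

/-- Brute-force search for a covering, on the code of an instance. -/
def CoverSearch (R : ℕ → ℕ → Prop) (x : List (List Bool) × List (List Bool)) : Prop :=
  (∀ s ∈ x.2, s = []) ∧ ∃ m < x.2.length + 1, R x.2.length m ∧
    ∃ w ∈ tuples [true, false] (m / 8 * (m / 8)), ∃ f ∈ tuples (List.range m) x.2.length,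
      ∀ u < x.2.length,
        (∀ v < x.2.length, (x.1.getD u []).getD v false = true →
          DoubleAdj m w (f.getD u 0) (f.getD v 0)) ∧
        (∀ v < x.2.length, ∀ v' < x.2.length, (x.1.getD u []).getD v false = true →
          (x.1.getD u []).getD v' false = true → f.getD v 0 = f.getD v' 0 → v = v') ∧
        ∀ j < m, DoubleAdj m w (f.getD u 0) j →
          ∃ v < x.2.length, (x.1.getD u []).getD v false = true ∧ f.getD v 0 = j

theorem primrecPred_coverSearch {R : ℕ → ℕ → Prop} (hR : PrimrecRel R) :
    PrimrecPred (CoverSearch R) := by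
  refine .and (.forall_mem_comp (by fun_prop) (.eq_comp (by fun_prop) (.const _)))
    (.exists_lt_comp (by fun_prop) (.and (PrimrecRel.comp hR (by fun_prop) (by fun_prop))
    (.exists_mem_comp (by fun_prop) (.exists_mem_comp (by fun_prop)
    (.forall_lt_comp (by fun_prop) (.and ?_ (.and ?_ ?_)))))))
  · refine .forall_lt_comp (by fun_prop) (.imp (.eq_comp (by fun_prop) (.const _))
      (primrecPred_doubleAdj ?_ ?_ ?_ ?_))
    all_goals fun_prop
  · refine .forall_lt_comp (by fun_prop) (.forall_lt_comp (by fun_prop)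
      (.imp (.eq_comp (by fun_prop) (.const _)) (.imp (.eq_comp (by fun_prop) (.const _))
      (.imp (.eq_comp ?_ ?_) (.eq_comp ?_ ?_)))))
    all_goals fun_prop
  · refine .forall_lt_comp (by fun_prop) (.imp (primrecPred_doubleAdj ?_ ?_ ?_ ?_)
      (.exists_lt_comp (by fun_prop) (.and (.eq_comp ?_ (.const _)) (.eq_comp ?_ ?_))))
    all_goals fun_prop

theorem Network.getD_code (I : Network) (u v : I.Node) :
    (I.code.1.getD u []).getD v false = true ↔ I.graph.Adj u v := by
  simp [Network.code, List.getD_eq_getElem?_getD]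

theorem Network.length_code (I : Network) : I.code.2.length = I.size := by
  simp [Network.code]

theorem Network.forall_mem_code (I : Network) :
    (∀ s ∈ I.code.2, s = []) ↔ ∀ v, I.input v = [] := by
  simp [Network.code, List.mem_ofFn]

theorem coverSearch_code_iff (R : ℕ → ℕ → Prop) (I : Network) :
    CoverSearch R I.code ↔ I ∈ coverLanguage R := by
  unfold CoverSearch
  rw [I.forall_mem_code, I.length_code]
  refine and_congr_right fun _ => ?_
  constructor
  · rintro ⟨m, -, hR, w, -, f, hf, h⟩
    obtain ⟨hlen, hmem⟩ := (mem_tuples _ _ _).1 hf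
    have hlt : ∀ v : I.Node, f.getD v 0 < m := by
      intro v
      have hv : (v : ℕ) < f.length := by rw [hlen]; exact v.2
      rw [List.getD_eq_getElem _ _ hv]
      exact List.mem_range.1 (hmem _ (List.getElem_mem hv))
    refine ⟨m, hR, _, fun v => ⟨f.getD v 0, hlt v⟩,
      isCovering_doubleGraph_iff (w := w).2 fun u => ?_⟩
    obtain ⟨h1, h2, h3⟩ := h u u.2
    refine ⟨fun v hv => h1 v v.2 ((I.getD_code u v).2 hv), fun v v' hv hv' he => ?_, ?_⟩
    · exact Fin.ext (h2 v v.2 v' v'.2 ((I.getD_code u v).2 hv) ((I.getD_code u v').2 hv') he)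
    · intro j hj hadj
      obtain ⟨v, hv, hv', he⟩ := h3 j hj hadj
      exact ⟨⟨v, hv⟩, (I.getD_code u ⟨v, hv⟩).1 hv', he⟩
  · rintro ⟨m, hR, M, f, hf⟩
    have hm : 0 < m := (f ⟨0, I.size_pos⟩).pos
    have hle : m ≤ I.size := by
      simpa using Fintype.card_le_of_surjective f (hf.surjective (connected_doubleGraph hm M M))
    rw [← doubleGraph_bitList, isCovering_doubleGraph_iff] at hf
    have hget : ∀ v (hv : v < I.size),
        (List.ofFn fun v => (f v : ℕ)).getD v 0 = f ⟨v, hv⟩ := by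
      intro v hv
      simp [List.getD_eq_getElem?_getD, hv]
    refine ⟨m, by omega, hR, bitList m M, (mem_tuples _ _ _).2 ⟨by simp [bitList], ?_⟩,
      List.ofFn fun v => (f v : ℕ), (mem_tuples _ _ _).2 ⟨by simp, ?_⟩, ?_⟩
    · intro a _
      cases a <;> simp
    · intro a ha
      obtain ⟨v, rfl⟩ := (List.mem_ofFn' _ _).1 ha
      exact List.mem_range.2 (f v).2
    · intro u hu
      obtain ⟨h1, h2, h3⟩ := hf ⟨u, hu⟩
      refine ⟨fun v hv hadj => ?_, fun v hv v' hv' hadj hadj' he => ?_, fun j hj hadj => ?_⟩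
      · rw [hget u hu, hget v hv]
        exact h1 ⟨v, hv⟩ ((I.getD_code ⟨u, hu⟩ ⟨v, hv⟩).1 hadj)
      · rw [hget v hv, hget v' hv'] at he
        exact congrArg Fin.val (h2 ⟨v, hv⟩ ⟨v', hv'⟩ ((I.getD_code ⟨u, hu⟩ ⟨v, hv⟩).1 hadj)
          ((I.getD_code ⟨u, hu⟩ ⟨v', hv'⟩).1 hadj') he)
      · rw [hget u hu] at hadj
        obtain ⟨v, hv, he⟩ := h3 j hj hadj
        exact ⟨v, v.2, (I.getD_code ⟨u, hu⟩ v).2 hv, (hget v v.2).trans he⟩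

theorem mem_coverLanguage_of_isomorphic {R : ℕ → ℕ → Prop} {I J : Network} (h : I.Isomorphic J)
    (hJ : J ∈ coverLanguage R) : I ∈ coverLanguage R := by
  obtain ⟨e, he⟩ := h
  obtain ⟨hJ, m, hR, M, f, hf⟩ := hJ
  have hs : I.size = J.size := by simpa using Fintype.card_congr e.toEquiv
  exact ⟨fun v => by rw [← he, hJ], m, hs ▸ hR, M, f ∘ e, hf.comp (IsCovering.of_iso e)⟩

theorem Network.Isomorphic.symm {I J : Network} (h : I.Isomorphic J) : J.Isomorphic I := by
  obtain ⟨e, he⟩ := h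
  exact ⟨e.symm, fun v => by simpa using (he (e.symm v)).symm⟩

theorem isDistributedLanguage_coverLanguage {R : ℕ → ℕ → Prop} (hR : PrimrecRel R) :
    IsDistributedLanguage (coverLanguage R) := by
  obtain ⟨d, hd, h⟩ := (primrecPred_coverSearch hR).exists_computable
  refine ⟨fun I J hIJ => ⟨mem_coverLanguage_of_isomorphic hIJ.symm,
    mem_coverLanguage_of_isomorphic hIJ⟩, d, hd, fun I => ?_⟩
  exact (coverSearch_code_iff R I).symm.trans (h _)

/-! ### Verification of the covering languages -/

/-- A certificate claims a number `m` of vertices, a matrix and a vertex of the covered graph. It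
is a word of ones, whose length is the number that encodes this triple. -/
def readCertificate (c : List Bool) : ℕ × List Bool × ℕ :=
  (Encodable.decode c.length).getD (0, [], 0)

/-- The certificate that claims the given triple. -/
def writeCertificate (x : ℕ × List Bool × ℕ) : List Bool :=
  List.replicate (Encodable.encode x) true

theorem readCertificate_writeCertificate (x : ℕ × List Bool × ℕ) :
    readCertificate (writeCertificate x) = x := by
  simp [readCertificate, writeCertificate]

@[fun_prop]
theorem primrec_readCertificate {α : Type*} [Primcodable α] {f : α → List Bool} (hf : Primrec f) :
    Primrec fun a => readCertificate (f a) :=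
  Primrec.option_getD.comp (Primrec.decode.comp (Primrec.length_comp hf)) (Primrec.const _)

/-- The condition checked in one round by a node: all certificates in its ball claim the same graph,
of an allowed size, and the claimed images of its neighbours are the neighbours of its own claimed
image, without repetition. -/
def CoverCheck (R : ℕ → Prop) (x : LocalView) : Prop :=
  ∀ r ∈ x.2, r.1 = x.1 → r.2.1 = [] ∧
    R (readCertificate r.2.2.1).1 ∧
    (readCertificate r.2.2.1).2.2 < (readCertificate r.2.2.1).1 ∧
    (∀ s ∈ x.2, ¬ s.1 = x.1 →
      (readCertificate s.2.2.1).1 = (readCertificate r.2.2.1).1 ∧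
      (readCertificate s.2.2.1).2.1 = (readCertificate r.2.2.1).2.1 ∧
      DoubleAdj (readCertificate r.2.2.1).1 (readCertificate r.2.2.1).2.1
        (readCertificate r.2.2.1).2.2 (readCertificate s.2.2.1).2.2) ∧
    (∀ s ∈ x.2, ∀ s' ∈ x.2, ¬ s.1 = x.1 → ¬ s'.1 = x.1 →
      (readCertificate s.2.2.1).2.2 = (readCertificate s'.2.2.1).2.2 → s.1 = s'.1) ∧
    ∀ j < (readCertificate r.2.2.1).1, DoubleAdj (readCertificate r.2.2.1).1
        (readCertificate r.2.2.1).2.1 (readCertificate r.2.2.1).2.2 j →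
      ∃ s ∈ x.2, ¬ s.1 = x.1 ∧ (readCertificate s.2.2.1).2.2 = j

theorem primrecPred_coverCheck {R : ℕ → Prop} (hR : PrimrecPred R) :
    PrimrecPred (CoverCheck R) := by
  refine .forall_mem_comp (by fun_prop) (.imp (.eq_comp (by fun_prop) (by fun_prop))
    (.and (.eq_comp (by fun_prop) (.const _)) (.and (hR.comp (by fun_prop))
    (.and (.lt_comp (by fun_prop) (by fun_prop)) (.and ?_ (.and ?_ ?_))))))
  · refine .forall_mem_comp (by fun_prop) (.imp (.not (.eq_comp ?_ ?_)) (.and (.eq_comp ?_ ?_)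
      (.and (.eq_comp ?_ ?_) (primrecPred_doubleAdj ?_ ?_ ?_ ?_))))
    all_goals fun_prop
  · refine .forall_mem_comp (by fun_prop) (.forall_mem_comp (by fun_prop)
      (.imp (.not (.eq_comp ?_ ?_)) (.imp (.not (.eq_comp ?_ ?_)) (.imp (.eq_comp ?_ ?_)
      (.eq_comp ?_ ?_)))))
    all_goals fun_prop
  · refine .forall_lt_comp (by fun_prop) (.imp (primrecPred_doubleAdj ?_ ?_ ?_ ?_)
      (.exists_mem_comp (by fun_prop) (.and (.not (.eq_comp ?_ ?_)) (.eq_comp ?_ ?_))))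
    all_goals fun_prop

namespace Network

theorem mem_ballList {I : Network} {ident : I.Node → ℕ} {t : ℕ} {u v : I.Node} :
    v ∈ I.ballList ident t u ↔ v ∈ I.ball u t := by
  simp [ballList, List.mem_mergeSort]

theorem coverCheck_view_iff {I : Network} {ident : I.Node → ℕ} (hi : Function.Injective ident)
    (cert : I.Node → List Bool) (R : ℕ → Prop) (u : I.Node) :
    CoverCheck R (I.view ident cert 1 u) ↔ I.input u = [] ∧
      R (readCertificate (cert u)).1 ∧
      (readCertificate (cert u)).2.2 < (readCertificate (cert u)).1 ∧
      (∀ v, I.graph.Adj u v →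
        (readCertificate (cert v)).1 = (readCertificate (cert u)).1 ∧
        (readCertificate (cert v)).2.1 = (readCertificate (cert u)).2.1 ∧
        DoubleAdj (readCertificate (cert u)).1 (readCertificate (cert u)).2.1
          (readCertificate (cert u)).2.2 (readCertificate (cert v)).2.2) ∧
      (∀ v v', I.graph.Adj u v → I.graph.Adj u v' →
        (readCertificate (cert v)).2.2 = (readCertificate (cert v')).2.2 → v = v') ∧
      ∀ j < (readCertificate (cert u)).1, DoubleAdj (readCertificate (cert u)).1
          (readCertificate (cert u)).2.1 (readCertificate (cert u)).2.2 j →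
        ∃ v, I.graph.Adj u v ∧ (readCertificate (cert v)).2.2 = j := by
  have hb : ∀ v, v ∈ I.ball u 1 ∧ ¬ v = u ↔ I.graph.Adj u v := by
    intro v
    rw [mem_ball_one]
    exact ⟨fun h => h.1.resolve_left h.2, fun h => ⟨Or.inr h, h.ne'⟩⟩
  have hu : u ∈ I.ball u 1 := (I.mem_ball_one u u).2 (Or.inl rfl)
  have hex : ∀ {P : ℕ × List Bool × List Bool × List ℕ → Prop} {l : List I.Node}
      {g : I.Node → ℕ × List Bool × List Bool × List ℕ},
      (∃ s ∈ l.map g, P s) ↔ ∃ v ∈ l, P (g v) := by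
    intro P l g
    simp
  simp only [CoverCheck, view, List.forall_mem_map, hex, mem_ballList, hi.eq_iff]
  constructor
  · intro h
    obtain ⟨h1, h2, h3, h4, h5, h6⟩ := h u hu rfl
    refine ⟨h1, h2, h3, fun v hv => ?_, fun v v' hv hv' => ?_, fun j hj hadj => ?_⟩
    · exact h4 v ((hb v).2 hv).1 ((hb v).2 hv).2
    · exact h5 v ((hb v).2 hv).1 v' ((hb v').2 hv').1 ((hb v).2 hv).2 ((hb v').2 hv').2
    · obtain ⟨v, hv, hne, he⟩ := h6 j hj hadj
      exact ⟨v, (hb v).1 ⟨hv, hne⟩, he⟩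
  · rintro ⟨h1, h2, h3, h4, h5, h6⟩ _ - rfl
    refine ⟨h1, h2, h3, fun v hv hne => h4 v ((hb v).1 ⟨hv, hne⟩), ?_, fun j hj hadj => ?_⟩
    · exact fun v hv v' hv' hne hne' => h5 v v' ((hb v).1 ⟨hv, hne⟩) ((hb v').1 ⟨hv', hne'⟩)
    · obtain ⟨v, hv, he⟩ := h6 j hj hadj
      exact ⟨v, ((hb v).2 hv).1, ((hb v).2 hv).2, he⟩

end Network

/-- Along an accepting run all nodes of the connected instance claim the same graph, and their
claimed images form a covering of that graph. -/
theorem mem_coverLanguage_of_coverCheck {R : ℕ → Prop} {I : Network} {ident : I.Node → ℕ}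
    (hi : Function.Injective ident) {cert : I.Node → List Bool}
    (h : ∀ u, CoverCheck R (I.view ident cert 1 u)) : I ∈ coverLanguage fun _ => R := by
  simp only [Network.coverCheck_view_iff hi] at h
  have hwalk : ∀ v v', (readCertificate (cert v)).1 = (readCertificate (cert v')).1 ∧
      (readCertificate (cert v)).2.1 = (readCertificate (cert v')).2.1 := by
    intro v v'
    obtain ⟨p⟩ := I.connected.preconnected v v'
    induction p with
    | nil => exact ⟨rfl, rfl⟩
    | cons hadj _ ih =>
      obtain ⟨h1, h2, -⟩ := (h _).2.2.2.1 _ hadj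
      exact ⟨h1.symm.trans ih.1, h2.symm.trans ih.2⟩
  have hconst := fun v => hwalk v ⟨0, I.size_pos⟩
  generalize (readCertificate (cert ⟨0, I.size_pos⟩)).1 = m at hconst
  generalize (readCertificate (cert ⟨0, I.size_pos⟩)).2.1 = w at hconst
  simp only [fun v => (hconst v).1, fun v => (hconst v).2, true_and] at h
  exact ⟨fun v => (h v).1, m, (h ⟨0, I.size_pos⟩).2.1, _,
    fun v => ⟨(readCertificate (cert v)).2.2, (h v).2.2.1⟩,
    isCovering_doubleGraph_iff (w := w).2 fun u => (h u).2.2.2⟩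

theorem exists_coverCheck {R : ℕ → Prop} {I : Network} (h : I ∈ coverLanguage fun _ => R) :
    ∃ cert, ∀ ident : I.Node → ℕ, Function.Injective ident →
      ∀ u, CoverCheck R (I.view ident cert 1 u) := by
  obtain ⟨hI, m, hR, M, f, hf⟩ := h
  rw [← doubleGraph_bitList, isCovering_doubleGraph_iff] at hf
  refine ⟨fun v => writeCertificate (m, bitList m M, f v), fun ident hi u => ?_⟩
  simp only [Network.coverCheck_view_iff hi, readCertificate_writeCertificate, true_and]
  exact ⟨hI u, hR, (f u).2, hf u⟩

theorem coverLanguage_mem_NLD {R : ℕ → Prop} (hR : PrimrecPred R) :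
    (coverLanguage fun _ => R) ∈ NLD := by
  obtain ⟨A, hA, h⟩ := (primrecPred_coverCheck hR).exists_computable
  refine ⟨isDistributedLanguage_coverLanguage (hR.comp Primrec.snd), 1, A, hA, fun I hI => ?_,
    fun I hI cert ident hi hacc => ?_⟩
  · obtain ⟨cert, hc⟩ := exists_coverCheck hI
    exact ⟨cert, fun ident hi u => (h _).1 (hc ident hi u)⟩
  · exact hI (mem_coverLanguage_of_coverCheck hi fun u => (h _).2 (hacc u))

/-! ### Locality of views -/

theorem SimpleGraph.Connected.dist_le_succ_iff {V : Type*} {G : SimpleGraph V} (hG : G.Connected)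
    {u v : V} {d : ℕ} : G.dist u v ≤ d + 1 ↔ ∃ w, G.dist u w ≤ d ∧ (w = v ∨ G.Adj w v) := by
  constructor
  · intro h
    obtain ⟨p, hp⟩ := hG.exists_walk_length_eq_dist v u
    rw [SimpleGraph.dist_comm, ← hp] at h
    cases p with
    | nil => exact ⟨_, by simp, Or.inl rfl⟩
    | @cons _ w _ hadj q =>
      refine ⟨w, ?_, Or.inr hadj.symm⟩
      rw [SimpleGraph.dist_comm]
      have := SimpleGraph.dist_le q
      rw [SimpleGraph.Walk.length_cons] at h
      omega
  · rintro ⟨w, hw, rfl | hadj⟩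
    · omega
    · have := hG.dist_triangle (u := u) (v := w) (w := v)
      rw [SimpleGraph.dist_eq_one_iff_adj.2 hadj] at this
      omega

/-- If two connected graphs have the same edges at each vertex of the ball of radius `t` around `u`
in the first graph, the distances from `u` agree up to `t`. -/
theorem dist_le_iff_of_agree {V : Type*} {G G' : SimpleGraph V} (hG : G.Connected)
    (hG' : G'.Connected) {u : V} {t : ℕ}
    (h : ∀ v, G.dist u v ≤ t → ∀ w, G.Adj v w ↔ G'.Adj v w) (d : ℕ) (hd : d ≤ t) (v : V) :
    G.dist u v ≤ d ↔ G'.dist u v ≤ d := by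
  induction d generalizing v with
  | zero =>
    rw [Nat.le_zero, Nat.le_zero, hG.dist_eq_zero_iff, hG'.dist_eq_zero_iff]
  | succ d ih =>
    rw [hG.dist_le_succ_iff, hG'.dist_le_succ_iff]
    refine exists_congr fun w => ?_
    rw [← ih (by omega)]
    refine and_congr_right fun hw => or_congr Iff.rfl (h w (by omega) v)

/-- The view of a node depends only on the edges at, and the certificates of, the nodes of its ball.
-/
theorem view_eq_of_agree {n : ℕ} {G G' : SimpleGraph (Fin n)} (hG : G.Connected)
    (hG' : G'.Connected) (input : Fin n → List Bool) (ident : Fin n → ℕ)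
    {cert cert' : Fin n → List Bool} {t : ℕ} {u : Fin n}
    (h : ∀ v, G.dist u v ≤ t → ∀ w, G.Adj v w ↔ G'.Adj v w)
    (hc : ∀ v, G.dist u v ≤ t → cert v = cert' v) :
    Network.view ⟨n, G, hG, input⟩ ident cert t u =
      Network.view ⟨n, G', hG', input⟩ ident cert' t u := by
  have hd := dist_le_iff_of_agree hG hG' h
  have hball : ∀ v, v ∈ Network.ball ⟨n, G, hG, input⟩ u t ↔
      v ∈ Network.ball ⟨n, G', hG', input⟩ u t := fun v => hd t le_rfl v
  have hdist : ∀ v, G.dist u v ≤ t → G.dist u v = G'.dist u v := by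
    intro v hv
    have h1 := (hd _ hv v).1 le_rfl
    exact le_antisymm ((hd _ (h1.trans hv) v).2 le_rfl) h1
  have hadj : ∀ v w, Network.BallAdj ⟨n, G, hG, input⟩ u t v w ↔
      Network.BallAdj ⟨n, G', hG', input⟩ u t v w := by
    intro v w
    refine (and_congr_right fun hv => ?_).trans (and_congr_left fun _ => hball v)
    refine (and_congr_right fun hw => ?_).trans (and_congr_left fun _ => hball w)
    change G.dist u v ≤ t at hv
    change G.dist u w ≤ t at hw
    change G.Adj v w ∧ ¬ (G.dist u v = t ∧ G.dist u w = t) ↔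
      G'.Adj v w ∧ ¬ (G'.dist u v = t ∧ G'.dist u w = t)
    rw [h v hv w, hdist v hv, hdist w hw]
  have hlist : Network.ballList ⟨n, G, hG, input⟩ ident t u =
      Network.ballList ⟨n, G', hG', input⟩ ident t u := by
    exact congrArg (fun l => List.mergeSort l _)
      (List.filter_congr fun v _ => decide_eq_decide.2 (hball v))
  unfold Network.view
  rw [← hlist]
  refine Prod.ext rfl (List.map_congr_left fun v hv => ?_)
  rw [hc v (Network.mem_ballList.1 hv)]
  exact congrArg (fun l => (ident v, input v, cert' v, List.map ident l))
    (List.filter_congr fun w _ => decide_eq_decide.2 (hadj v w))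

theorem le_add_dist_of_lipschitz {V : Type*} {G : SimpleGraph V} (hG : G.Connected) {φ : V → ℕ}
    (h : ∀ u v, G.Adj u v → φ u ≤ φ v + 1) (u v : V) : φ u ≤ φ v + G.dist u v := by
  obtain ⟨p, hp⟩ := hG.exists_walk_length_eq_dist u v
  rw [← hp]
  clear hp
  induction p with
  | nil => simp
  | cons hadj _ ih =>
    have := h _ _ hadj
    rw [SimpleGraph.Walk.length_cons]
    omega

/-! ### Splicing two accepted graphs -/

/-- The position of the vertex `v` on the segment between the two blocks of a graph `doubleGraph n`:
it is `0` on the left block and takes its maximum, `2 * (n / 8) - 1`, on the right block. -/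
def segmentPos (n v : ℕ) : ℕ := min v (4 * (n / 8)) - (2 * (n / 8) + 1)

theorem DoubleRel.segmentPos_le {n : ℕ} {M M' : ℕ → Bool} {i j : ℕ} (h : DoubleRel n M M' i j) :
    segmentPos n i ≤ segmentPos n j ∧ segmentPos n j ≤ segmentPos n i + 1 := by
  unfold segmentPos
  have hk : 8 * (n / 8) ≤ n := Nat.mul_div_le n 8
  have hlt := h.lt
  rcases h with h | h | ⟨c, hc, -, h1, h2⟩ | ⟨c, hc, -, h1, h2⟩
  · omega
  · omega
  all_goals
    have hpos : 0 < n / 8 := Nat.pos_of_mul_pos_right (by omega : 0 < n / 8 * (n / 8))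
    have := Nat.mod_lt c hpos
    have := Nat.div_lt_of_lt_mul hc
    obtain ⟨x, hx⟩ : ∃ x, c / (n / 8) = x := ⟨_, rfl⟩
    rw [hx] at h1 this
    omega

theorem segmentPos_lipschitz {n : ℕ} {M M' : ℕ → Bool} (u v : Fin n)
    (h : (doubleGraph n M M').Adj u v) : segmentPos n u ≤ segmentPos n v + 1 := by
  rcases h with h | h <;> have := h.segmentPos_le <;> omega

theorem DoubleRel.congr_right {n : ℕ} {M M' N' : ℕ → Bool} {i j : ℕ}
    (hij : segmentPos n i < 2 * (n / 8) - 1 ∨ segmentPos n j < 2 * (n / 8) - 1)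
    (h : DoubleRel n M M' i j) : DoubleRel n M N' i j := by
  rcases h with h | h | h | ⟨c, hc, -, h1, h2⟩
  · exact Or.inl h
  · exact Or.inr (Or.inl h)
  · exact Or.inr (Or.inr (Or.inl h))
  · unfold segmentPos at hij
    have := h1 ▸ Nat.le_add_right (4 * (n / 8)) (c / (n / 8))
    omega

theorem DoubleRel.congr_left {n : ℕ} {M N M' : ℕ → Bool} {i j : ℕ}
    (hij : 0 < segmentPos n i ∨ 0 < segmentPos n j)
    (h : DoubleRel n M M' i j) : DoubleRel n N M' i j := by
  rcases h with h | h | ⟨c, hc, -, h1, h2⟩ | h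
  · exact Or.inl h
  · exact Or.inr (Or.inl h)
  · unfold segmentPos at hij
    have hpos : 0 < n / 8 := Nat.pos_of_mul_pos_right (by omega : 0 < n / 8 * (n / 8))
    have := Nat.mod_lt c hpos
    have := Nat.div_lt_of_lt_mul hc
    obtain ⟨x, hx⟩ : ∃ x, c / (n / 8) = x := ⟨_, rfl⟩
    rw [hx] at h1 this
    omega
  · exact Or.inr (Or.inr (Or.inr h))

theorem doubleGraph_adj_congr_right {n : ℕ} {M M' N' : ℕ → Bool} {u v : Fin n}
    (h : segmentPos n u < 2 * (n / 8) - 1) :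
    (doubleGraph n M M').Adj u v ↔ (doubleGraph n M N').Adj u v :=
  or_congr ⟨.congr_right (.inl h), .congr_right (.inl h)⟩
    ⟨.congr_right (.inr h), .congr_right (.inr h)⟩

theorem doubleGraph_adj_congr_left {n : ℕ} {M N M' : ℕ → Bool} {u v : Fin n}
    (h : 0 < segmentPos n u) :
    (doubleGraph n M M').Adj u v ↔ (doubleGraph n N M').Adj u v :=
  or_congr ⟨.congr_left (.inl h), .congr_left (.inl h)⟩
    ⟨.congr_left (.inr h), .congr_left (.inr h)⟩

/-- If accepted certificates of `doubleGraph n M M` and of `doubleGraph n M' M'` coincide on a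
window of `2 * t` vertices between the blocks, then the first ones to the left of the middle of the
window and the second ones to the right of it are accepted on `doubleGraph n M M'`: no node sees
the difference in its ball of radius `t`. -/
theorem allAccept_splice {n t : ℕ} (hn : 0 < n) (ht : t < n / 8) {A : LocalView → Bool}
    {ident : Fin n → ℕ} {M M' : ℕ → Bool} {cert cert' : Fin n → List Bool}
    (h : (doubleNetwork n hn M M).AllAccept t A ident cert)
    (h' : (doubleNetwork n hn M' M').AllAccept t A ident cert')
    (hw : ∀ v : Fin n, 0 < segmentPos n v → segmentPos n v ≤ 2 * t → cert v = cert' v) :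
    (doubleNetwork n hn M M').AllAccept t A ident
      fun v => if segmentPos n v ≤ t then cert v else cert' v := by
  intro (u : Fin n)
  have hG := connected_doubleGraph hn M M'
  have hpos := le_add_dist_of_lipschitz hG (φ := fun v => segmentPos n v) segmentPos_lipschitz
  by_cases hu : segmentPos n u ≤ t
  · have hball : ∀ v, (doubleGraph n M M').dist u v ≤ t → segmentPos n v ≤ 2 * t := by
      intro v hv
      have := hpos v u
      rw [SimpleGraph.dist_comm] at this
      omega
    rw [← h u]
    refine congrArg A (view_eq_of_agree hG (connected_doubleGraph hn M M) _ _
      (fun v hv w => ?_) fun v hv => ?_)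
    · exact doubleGraph_adj_congr_right (by have := hball v hv; omega)
    · split_ifs with hvt
      · rfl
      · exact (hw v (by omega) (hball v hv)).symm
  · have hball : ∀ v, (doubleGraph n M M').dist u v ≤ t → 0 < segmentPos n v := by
      intro v hv
      have := hpos u v
      omega
    rw [← h' u]
    refine congrArg A (view_eq_of_agree hG (connected_doubleGraph hn M' M') _ _
      (fun v hv w => ?_) fun v hv => ?_)
    · exact doubleGraph_adj_congr_left (hball v hv)
    · split_ifs with hvt
      · exact hw v (hball v hv) (by omega)
      · rfl

/-! ### Graphs with one leaf -/

/-- For `8 ≤ n`, the graph `doubleGraph n M M'` has exactly one leaf, so that it is in the seed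
language of the family only if it is in the family. -/
theorem exists_iso_of_mem_seedLanguage {n : ℕ} (hn : 8 ≤ n) {M M' : ℕ → Bool}
    (h : doubleNetwork n (by omega) M M' ∈ SeedLanguage (⋃ m, equalityFamily m)) :
    ∃ N, Nonempty (doubleGraph n M M' ≃g doubleGraph n N N) := by
  obtain ⟨m, hm⟩ := (mem_seedLanguage_iUnion _ _).1 h
  obtain ⟨-, N, f, hf⟩ := mem_seedLanguage_equalityFamily.1 hm
  change Fin n → Fin m at f
  change IsCovering (doubleGraph n M M') _ f at hf
  have hm : 0 < m := (f ⟨0, by omega⟩).pos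
  have hb : Function.Bijective f := by
    refine hf.bijective_of_unique_leaf (connected_doubleGraph hm N N) ⟨0, by omega⟩ ?_ ?_
    · have key : ∀ u : Fin n, (doubleGraph n M M').Adj ⟨0, by omega⟩ u → (u : ℕ) = 1 := by
        rintro u (h | h)
        · change DoubleRel n M M' 0 u at h
          rcases h with h | h | ⟨c, -, -, h1, -⟩ | ⟨c, -, -, h1, -⟩
          · exact h
          · omega
          · have := Nat.zero_le (c / (n / 8))
            omega
          · have : 0 < n / 8 := by omega
            have := h1 ▸ Nat.le_add_right (4 * (n / 8)) (c / (n / 8))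
            omega
        · exact absurd h.lt (Nat.not_lt_zero _)
      exact fun u u' hu hu' => Fin.ext ((key u hu).trans (key u' hu').symm)
    · intro v hv
      have hv : 0 < (v : ℕ) := Nat.pos_of_ne_zero fun h => hv (Fin.ext h)
      have hvn := v.2
      by_cases h : (v : ℕ) + 1 < n
      · refine ⟨⟨v - 1, by omega⟩, ⟨v + 1, h⟩, Or.inr (Or.inl ?_), Or.inl (Or.inl rfl), ?_⟩
        · simp only
          omega
        · simp only [ne_eq, Fin.mk.injEq]
          omega
      · refine ⟨⟨v - 1, by omega⟩, ⟨v - 2, by omega⟩, Or.inr (Or.inl ?_),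
          Or.inr (Or.inr (Or.inl ?_)), ?_⟩
        · simp only
          omega
        · simp only
          omega
        · simp only [ne_eq, Fin.mk.injEq]
          omega
  obtain rfl : n = m := by simpa using Fintype.card_of_bijective hb
  exact ⟨N, hf.nonempty_iso hb⟩

/-! ### Counting -/

theorem doubleRel_left_iff {n : ℕ} {M M' : ℕ → Bool} {c : ℕ} (hc : c < n / 8 * (n / 8)) :
    DoubleRel n M M' (1 + c / (n / 8)) (n / 8 + 2 + c % (n / 8)) ↔ M c = true := by
  have hk : 8 * (n / 8) ≤ n := Nat.mul_div_le n 8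
  have hpos : 0 < n / 8 := Nat.pos_of_mul_pos_right (by omega : 0 < n / 8 * (n / 8))
  have hmod := Nat.mod_lt c hpos
  have hdiv := Nat.div_lt_of_lt_mul hc
  refine ⟨?_, fun h => Or.inr (Or.inr (Or.inl ⟨c, hc, h, rfl, rfl⟩))⟩
  rintro (h | h | ⟨c', hc', hM, h1, h2⟩ | ⟨c', hc', hM, h1, h2⟩)
  · omega
  · omega
  · have h1 : c / (n / 8) = c' / (n / 8) := by omega
    have h2 : c % (n / 8) = c' % (n / 8) := by omega
    rw [← Nat.div_add_mod c (n / 8), h1, h2, Nat.div_add_mod]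
    exact hM
  · have := h1 ▸ Nat.le_add_right (4 * (n / 8)) (c' / (n / 8))
    omega

theorem doubleRel_right_iff {n : ℕ} {M M' : ℕ → Bool} {c : ℕ} (hc : c < n / 8 * (n / 8)) :
    DoubleRel n M M' (4 * (n / 8) + c / (n / 8)) (5 * (n / 8) + 1 + c % (n / 8)) ↔
      M' c = true := by
  have hk : 8 * (n / 8) ≤ n := Nat.mul_div_le n 8
  have hpos : 0 < n / 8 := Nat.pos_of_mul_pos_right (by omega : 0 < n / 8 * (n / 8))
  have hmod := Nat.mod_lt c hpos
  have hdiv := Nat.div_lt_of_lt_mul hc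
  refine ⟨?_, fun h => Or.inr (Or.inr (Or.inr ⟨c, hc, h, rfl, rfl⟩))⟩
  rintro (h | h | ⟨c', hc', hM, h1, h2⟩ | ⟨c', hc', hM, h1, h2⟩)
  · omega
  · omega
  · have := h1 ▸ Nat.le_add_right (4 * (n / 8)) (c / (n / 8))
    have := Nat.div_lt_of_lt_mul hc'
    omega
  · have h1 : c / (n / 8) = c' / (n / 8) := by omega
    have h2 : c % (n / 8) = c' % (n / 8) := by omega
    rw [← Nat.div_add_mod c (n / 8), h1, h2, Nat.div_add_mod]
    exact hM

/-- The graph `doubleGraph n M M'` determines the bits of `M` and `M'`. -/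
theorem eq_of_doubleGraph_eq {n : ℕ} {M M' N N' : ℕ → Bool}
    (h : doubleGraph n M M' = doubleGraph n N N') {c : ℕ} (hc : c < n / 8 * (n / 8)) :
    M c = N c ∧ M' c = N' c := by
  have hk : 8 * (n / 8) ≤ n := Nat.mul_div_le n 8
  have hpos : 0 < n / 8 := Nat.pos_of_mul_pos_right (by omega : 0 < n / 8 * (n / 8))
  have hmod := Nat.mod_lt c hpos
  have hdiv := Nat.div_lt_of_lt_mul hc
  have key : ∀ i j, i < j → j < n → (DoubleRel n M M' i j ↔ DoubleRel n N N' i j) := by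
    intro i j hij hj
    have h1 := doubleGraph_adj (M := M) (M' := M') (i := ⟨i, hij.trans hj⟩) (j := ⟨j, hj⟩)
    rw [h, doubleGraph_adj] at h1
    have h2 : ∀ {M M' : ℕ → Bool}, ¬ DoubleRel n M M' j i := fun h => absurd h.lt hij.not_gt
    simpa [h2] using h1.symm
  constructor
  · rw [Bool.eq_iff_iff, ← doubleRel_left_iff (M' := M') hc, ← doubleRel_left_iff (M' := N') hc]
    exact key _ _ (by omega) (by omega)
  · rw [Bool.eq_iff_iff, ← doubleRel_right_iff (M := M) hc, ← doubleRel_right_iff (M := N) hc]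
    exact key _ _ (by omega) (by omega)

/-- The matrix with the bits `b`, continued by `false`. -/
def extendBits {K : ℕ} (b : Fin K → Bool) (c : ℕ) : Bool :=
  if h : c < K then b ⟨c, h⟩ else false

theorem extendBits_of_lt {K : ℕ} (b : Fin K → Bool) {c : ℕ} (h : c < K) :
    extendBits b c = b ⟨c, h⟩ := dif_pos h

/-- A set `S` of matrices all of whose pairs give members of the family is small: there are at most
`n !` ways to relabel each of the `2 ^ ((n / 8) * (n / 8))` graphs that encode a matrix twice. -/
theorem sq_card_le_of_forall_iso {n : ℕ} (S : Finset (Fin (n / 8 * (n / 8)) → Bool))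
    (h : ∀ b ∈ S, ∀ b' ∈ S, ∃ N, Nonempty
      (doubleGraph n (extendBits b) (extendBits b') ≃g doubleGraph n N N)) :
    S.card ^ 2 ≤ n.factorial * 2 ^ (n / 8 * (n / 8)) := by
  classical
  have key : ∀ p : (Fin (n / 8 * (n / 8)) → Bool) × (Fin (n / 8 * (n / 8)) → Bool), p ∈ S ×ˢ S →
      ∃ q : Equiv.Perm (Fin n) × (Fin (n / 8 * (n / 8)) → Bool), ∀ i j,
        (doubleGraph n (extendBits p.1) (extendBits p.2)).Adj i j ↔
          (doubleGraph n (extendBits q.2) (extendBits q.2)).Adj (q.1 i) (q.1 j) := by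
    intro p hp
    obtain ⟨hp1, hp2⟩ := Finset.mem_product.1 hp
    obtain ⟨N, ⟨e⟩⟩ := h _ hp1 _ hp2
    have hN : doubleGraph n (extendBits fun c : Fin (n / 8 * (n / 8)) => N c)
        (extendBits fun c : Fin (n / 8 * (n / 8)) => N c) = doubleGraph n N N :=
      doubleGraph_congr (fun c hc => extendBits_of_lt _ hc) (fun c hc => extendBits_of_lt _ hc)
    refine ⟨(e.toEquiv, fun c => N c), fun i j => ?_⟩
    rw [hN]
    exact e.map_adj_iff.symm
  choose! g hg using key
  have hcard := Finset.card_le_card_of_injOn (s := S ×ˢ S) (t := Finset.univ) g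
    (fun _ _ => by simp) (fun p hp p' hp' he => ?_)
  · rw [Finset.card_product, ← sq] at hcard
    refine hcard.trans (le_of_eq ?_)
    simp [Fintype.card_perm]
  · have hgraph : doubleGraph n (extendBits p.1) (extendBits p.2) =
        doubleGraph n (extendBits p'.1) (extendBits p'.2) := by
      ext i j
      rw [hg p hp, hg p' hp', he]
    refine Prod.ext (funext fun c => ?_) (funext fun c => ?_)
    · simpa [extendBits_of_lt] using (eq_of_doubleGraph_eq hgraph c.2).1
    · simpa [extendBits_of_lt] using (eq_of_doubleGraph_eq hgraph c.2).2

/-- If every fibre of `g` has at most `√P` elements, its domain has at most `√P` times as many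
elements as its codomain. -/
theorem sq_card_le_of_fibers {α β : Type*} [Fintype α] [Fintype β] [DecidableEq β] (g : α → β)
    {P : ℕ} (h : ∀ y, (Finset.univ.filter fun a => g a = y).card ^ 2 ≤ P) :
    Fintype.card α ^ 2 ≤ Fintype.card β ^ 2 * P := by
  have h1 := Finset.card_eq_sum_card_fiberwise (f := g) (s := Finset.univ) (t := Finset.univ)
    (fun _ _ => by simp)
  have h2 := sq_sum_le_card_mul_sum_sq (s := (Finset.univ : Finset β))
    (f := fun y => (Finset.univ.filter fun a => g a = y).card)
  rw [← h1, Finset.card_univ, Finset.card_univ] at h2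
  refine h2.trans ?_
  rw [sq (Fintype.card β), mul_assoc]
  refine Nat.mul_le_mul le_rfl ((Finset.sum_le_sum fun y _ => h y).trans ?_)
  simp

/-- Short certificates lead to few certificate windows, so few matrices: the number of bits of a
matrix is bounded in terms of the length `L` of the certificates. -/
theorem pow_le_of_short_certificates {n t L : ℕ} (hn : 0 < n) (ht : t < n / 8)
    {A : LocalView → Bool}
    (hA : ∀ M M', (∃ cert, (doubleNetwork n hn M M').AllAccept t A Fin.val cert) →
      ∃ N, Nonempty (doubleGraph n M M' ≃g doubleGraph n N N))
    (hL : ∀ M, ∃ cert : Fin n → List Bool,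
      (doubleNetwork n hn M M).AllAccept t A Fin.val cert ∧ ∀ v, (cert v).length ≤ L) :
    2 ^ (n / 8 * (n / 8)) ≤ (3 ^ L) ^ (2 * t) * (3 ^ L) ^ (2 * t) * n.factorial := by
  classical
  have hk : 8 * (n / 8) ≤ n := Nat.mul_div_le n 8
  choose cert hcert hlen using hL
  -- The certificates of the `2 * t` vertices that follow the left block.
  let g : (Fin (n / 8 * (n / 8)) → Bool) → Fin (2 * t) → Fin L → Option Bool := fun b i p =>
    (cert (extendBits b) ⟨2 * (n / 8) + 2 + i, by omega⟩)[(p : ℕ)]?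
  have hfib : ∀ y, (Finset.univ.filter fun b => g b = y).card ^ 2 ≤
      n.factorial * 2 ^ (n / 8 * (n / 8)) := by
    intro y
    refine sq_card_le_of_forall_iso _ fun b hb b' hb' => hA _ _ ⟨_,
      allAccept_splice hn ht (hcert (extendBits b)) (hcert (extendBits b')) fun v hv hv' => ?_⟩
    have hb : g b = y := by simpa using hb
    have hb' : g b' = y := by simpa using hb'
    unfold segmentPos at hv hv'
    refine List.ext_getElem? fun p => ?_
    by_cases hp : p < L
    · have hi : (v : ℕ) - (2 * (n / 8) + 2) < 2 * t := by omega
      have hgg := congrFun (congrFun (hb.trans hb'.symm) ⟨_, hi⟩) ⟨p, hp⟩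
      have hv : (⟨2 * (n / 8) + 2 + ((v : ℕ) - (2 * (n / 8) + 2)), by omega⟩ : Fin n) = v :=
        Fin.ext (by simp only; omega)
      simpa only [g, hv] using hgg
    · rw [List.getElem?_eq_none ((hlen _ v).trans (not_lt.1 hp)),
        List.getElem?_eq_none ((hlen _ v).trans (not_lt.1 hp))]
  -- A list of length at most `L` is a function from `Fin L` to the three-element `Option Bool`.
  have h := sq_card_le_of_fibers g hfib
  simp only [Fintype.card_fun, Fintype.card_option, Fintype.card_bool, Fintype.card_fin,
    Nat.reduceAdd] at h
  refine Nat.le_of_mul_le_mul_right ?_ (Nat.two_pow_pos (n / 8 * (n / 8)))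
  calc _ = (2 ^ (n / 8 * (n / 8))) ^ 2 := (sq _).symm
    _ ≤ _ := h
    _ = _ := by ring

theorem thousand_mul_log_succ_le {n : ℕ} (hn : 2 ^ 14 ≤ n) : 1000 * (Nat.log 2 n + 1) ≤ n := by
  have key : ∀ j, 14 ≤ j → 1000 * (j + 1) ≤ 2 ^ j := by
    intro j hj
    induction j, hj using Nat.le_induction with
    | base => norm_num
    | succ j hj ih =>
      rw [pow_succ]
      omega
  have hlog : 14 ≤ Nat.log 2 n := Nat.le_log_of_pow_le (by norm_num) hn
  exact (key _ hlog).trans (Nat.pow_log_le_self 2 (by omega))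

theorem factorial_le_two_pow (n : ℕ) : n.factorial ≤ 2 ^ (n * (Nat.log 2 n + 1)) := by
  refine (Nat.factorial_le_pow n).trans ?_
  rw [mul_comm, pow_mul]
  exact Nat.pow_le_pow_left (Nat.lt_pow_succ_log_self (by norm_num) n).le n

/-- The bound in closed form: as `n / 8` is at least `n / 10` and `n !` is at most
`2 ^ (n ^ 2 / 1000)`, only certificates of quadratic length can make up for the `(n / 8) ^ 2` bits
of a matrix. -/
theorem sq_lt_mul_of_two_pow_le {n t L : ℕ} (hn : 2 ^ 14 + 8000 * t ≤ n)
    (h : 2 ^ (n / 8 * (n / 8)) ≤ (3 ^ L) ^ (2 * t) * (3 ^ L) ^ (2 * t) * n.factorial) :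
    (n : ℝ) ^ 2 < 10000 * (t + 1) * L := by
  have h3 : (3 ^ L) ^ (2 * t) ≤ 2 ^ (4 * t * L) := by
    calc (3 ^ L) ^ (2 * t) ≤ ((2 ^ 2) ^ L) ^ (2 * t) := by gcongr; norm_num
      _ = 2 ^ (4 * t * L) := by rw [← pow_mul, ← pow_mul]; congr 1; ring
  have hpow : 2 ^ (n / 8 * (n / 8)) ≤
      2 ^ (4 * t * L + 4 * t * L + n * (Nat.log 2 n + 1)) := by
    rw [pow_add, pow_add]
    exact h.trans (Nat.mul_le_mul (Nat.mul_le_mul h3 h3) (factorial_le_two_pow n))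
  have hexp := (Nat.pow_le_pow_iff_right (by norm_num)).1 hpow
  have hlog := thousand_mul_log_succ_le (by omega : 2 ^ 14 ≤ n)
  have hk : n ≤ 10 * (n / 8) := by omega
  generalize n / 8 = k at *
  generalize Nat.log 2 n + 1 = l at *
  have hexp : (k : ℝ) * k ≤ 4 * t * L + 4 * t * L + n * l := by exact_mod_cast hexp
  have hlog : 1000 * (l : ℝ) ≤ n := by exact_mod_cast hlog
  have hk : (n : ℝ) ≤ 10 * k := by exact_mod_cast hk
  have hn : (1 : ℝ) ≤ n := by exact_mod_cast (by omega : 1 ≤ n)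
  have hL : (0 : ℝ) ≤ L := Nat.cast_nonneg L
  have ht : (0 : ℝ) ≤ t := Nat.cast_nonneg t
  have hkk : (n : ℝ) * n ≤ 10 * k * (10 * k) := by gcongr
  have hnl : (n : ℝ) * (1000 * l) ≤ n * n := by gcongr
  nlinarith [mul_nonneg ht hL, mul_pos (zero_lt_one.trans_le hn) (zero_lt_one.trans_le hn)]

/-- The lower bound, for any algorithm that, with the identities `0, …, n - 1`, only accepts a graph
`doubleGraph n M M'` if it is isomorphic to one that encodes the same matrix twice. -/
theorem exists_matrix_of_long_certificates (t : ℕ) : ∃ c : ℝ, 0 < c ∧ ∃ N : ℕ, 8 ≤ N ∧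
    ∀ n ≥ N, ∀ (hn : 0 < n) (A : LocalView → Bool),
      (∀ M M', (∃ cert, (doubleNetwork n hn M M').AllAccept t A Fin.val cert) →
        ∃ N, Nonempty (doubleGraph n M M' ≃g doubleGraph n N N)) →
      ∃ M, ∀ cert : Fin n → List Bool, (doubleNetwork n hn M M).AllAccept t A Fin.val cert →
        ∃ v, c * (n : ℝ) ^ 2 ≤ ((cert v).length : ℝ) := by
  refine ⟨1 / (10000 * (t + 1)), by positivity, 2 ^ 14 + 8000 * t, by omega,
    fun n hnN hn A hA => ?_⟩
  by_contra! hcon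
  have hL : ∀ M, ∃ cert : Fin n → List Bool,
      (doubleNetwork n hn M M).AllAccept t A Fin.val cert ∧
        ∀ v, (cert v).length ≤ ⌊1 / (10000 * (t + 1)) * (n : ℝ) ^ 2⌋₊ := by
    intro M
    obtain ⟨cert, h, hlen⟩ := hcon M
    exact ⟨cert, h, fun v => Nat.le_floor (hlen v).le⟩
  have h := sq_lt_mul_of_two_pow_le hnN (pow_le_of_short_certificates hn (by omega) hA hL)
  have hfl : (⌊1 / (10000 * (t + 1)) * (n : ℝ) ^ 2⌋₊ : ℝ) ≤ 1 / (10000 * (t + 1)) * (n : ℝ) ^ 2 :=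
    Nat.floor_le (by positivity)
  have ht : (0 : ℝ) < 10000 * (t + 1) := by positivity
  have := h.trans_le (mul_le_mul_of_nonneg_left hfl ht.le)
  rw [← mul_assoc, mul_one_div_cancel ht.ne', one_mul] at this
  exact lt_irrefl _ this

/-! ### The separation -/

theorem mainTheorem6 :
    ∃ F : ℕ → Set Network,
      -- a decidable family of graphs, those in `F n` having `n` nodes
      (∀ n, ∀ I ∈ F n, I.size = n) ∧
      IsGraphLanguage (⋃ n, F n) ∧
      IsDistributedLanguage (⋃ n, F n) ∧
      -- every proof labeling scheme for `F n` needs labels of order `n ^ 2`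
      (∀ t : ℕ, ∃ c : ℝ, 0 < c ∧ ∃ N : ℕ, ∀ n ≥ N, ∀ A : LocalView → Bool,
        IsProofLabelingScheme n t A (F n) →
          ∃ I ∈ F n, ∃ ident : I.Node → ℕ, Function.Injective ident ∧
            ∀ label : I.Node → List Bool, I.AllAccept t A ident label →
              ∃ v, c * (n : ℝ) ^ 2 ≤ ((label v).length : ℝ)) ∧
      -- closure under lift and membership in NLD
      (∀ n, ClosedUnderLift 1 (SeedLanguage (F n)) ∧ SeedLanguage (F n) ∈ NLD) ∧
      ClosedUnderLift 1 (SeedLanguage (⋃ n, F n)) ∧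
      SeedLanguage (⋃ n, F n) ∈ NLD ∧
      -- agreement on graphs of prime size
      (∀ n : ℕ, n.Prime → ∀ I : Network, I.size = n →
        (I ∈ SeedLanguage (F n) ↔ I ∈ F n) ∧ (I ∈ SeedLanguage (⋃ k, F k) ↔ I ∈ F n)) ∧
      -- every algorithm verifying the seed language needs certificates of order `n ^ 2`
      (∀ t : ℕ, ∃ c : ℝ, 0 < c ∧ ∃ N : ℕ, ∀ A : LocalView → Bool,
        Verifies t A (SeedLanguage (⋃ k, F k)) →
          ∀ n ≥ N, ∃ I ∈ SeedLanguage (⋃ k, F k), I.size = n ∧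
            ∀ cert : I.Node → List Bool,
              (∀ ident : I.Node → ℕ, Function.Injective ident → I.AllAccept t A ident cert) →
                ∃ v, c * (n : ℝ) ^ 2 ≤ ((cert v).length : ℝ)) := by

  have hself : ∀ n (hn : 0 < n) M, doubleNetwork n hn M M ∈ equalityFamily n := fun n hn M =>
    ⟨fun _ => rfl, M, ⟨SimpleGraph.Iso.refl⟩⟩
  refine ⟨equalityFamily, fun n I hI => size_of_mem_equalityFamily hI, fun I hI => ?_, ?_,
    fun t => ?_, fun n => ⟨closedUnderLift_seedLanguage _, ?_⟩, closedUnderLift_seedLanguage _, ?_,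
    fun n hp I hI => ?_, fun t => ?_⟩
  · obtain ⟨n, hn⟩ := Set.mem_iUnion.1 hI
    exact hn.1
  · rw [iUnion_equalityFamily]
    exact isDistributedLanguage_coverLanguage (.eq_comp Primrec.snd Primrec.fst)
  · obtain ⟨c, hc, N, hN8, hN⟩ := exists_matrix_of_long_certificates t
    refine ⟨c, hc, N, fun n hn A hA => ?_⟩
    have hpos : 0 < n := by omega
    obtain ⟨M, hM⟩ := hN n hn hpos A fun M M' hacc =>
      ((hA (doubleNetwork n hpos M M') rfl Fin.val Fin.val_injective).2 hacc).2
    exact ⟨doubleNetwork n hpos M M, hself n hpos M, Fin.val, Fin.val_injective, hM⟩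
  · rw [seedLanguage_equalityFamily]
    exact coverLanguage_mem_NLD (.eq_comp Primrec.id (Primrec.const n))
  · rw [seedLanguage_iUnion_equalityFamily]
    exact coverLanguage_mem_NLD ⟨fun _ => instDecidableTrue, Primrec.const _⟩
  · subst hI
    refine ⟨mem_equalityFamily_iff.symm, fun h => ?_, fun h => ?_⟩
    · obtain ⟨m, hm⟩ := (mem_seedLanguage_iUnion _ _).1 h
      exact mem_equalityFamily_of_prime hp hm
    · exact (mem_seedLanguage_iUnion _ _).2 ⟨_, mem_equalityFamily_iff.1 h⟩
  · obtain ⟨c, hc, N, hN8, hN⟩ := exists_matrix_of_long_certificates t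
    refine ⟨c, hc, N, fun A hA n hn => ?_⟩
    have hpos : 0 < n := by omega
    obtain ⟨M, hM⟩ := hN n hn hpos A fun M M' ⟨cert, hacc⟩ => by
      refine exists_iso_of_mem_seedLanguage (by omega) ?_
      by_contra hnot
      exact hA.2 _ hnot cert Fin.val Fin.val_injective hacc
    refine ⟨doubleNetwork n hpos M M, (mem_seedLanguage_iUnion _ _).2 ⟨n, ?_⟩, rfl,
      fun cert hcert => hM cert (hcert Fin.val Fin.val_injective)⟩
    exact mem_equalityFamily_iff.1 (hself n hpos M)
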